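/- Let $T$ be a tree of order $n\ge 1$, let $D(T)$ be its distance matrix, whose $(v,w)$-entry is the length of a shortest path from $v$ to $w$ in $T$, and let $\delta_k(T)$ denote the coefficient of $x^k$ in $\det(D(T)-xI)$. Call a finite sequence $a_0,\dots,a_m$ of real numbers *log-concave* if $a_j^2\ge a_{j-1}a_{j+1}$ for all $1\le j\le m-1$, and *unimodal* if there is an index $k$ with $0\le k\le m$ such that $a_{i-1}\le a_i$ for $1\le i\le k$ and $a_i\ge a_{i+1}$ for $k\le i\le m-1$. Then: (i) The sequence $c_0,\dots,c_n$ of coefficients of the distance characteristic polynomial $\det(xI-D(T))=\sum_{k=0}^n c_kx^k$ is log-concave. Moreover, if $n\ge 2$: (ii) The sequence $|\delta_0(T)|,\dots,|\delta_{n-2}(T)|$ is log-concave and unimodal. (iii) The sequence $d_0(T),\dots,d_{n-2}(T)$ of normalized coefficients $d_k(T)=2^{k-n+2}|\delta_k(T)|$ is log-concave and unimodal. In particular, the unimodality part of the Graham–Lovász conjecture holds: for $n\ge 2$ the sequence of the quantities $(-1)^{n-1}\delta_k(T)/2^{n-k-2}$, $0\le k\le n-2$, is unimodal. -/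

import Mathlib

/-- The finite sequence `a 0, a 1, …, a m` is log-concave:
`a j ^ 2 ≥ a (j - 1) * a (j + 1)` for all `j = 1, …, m - 1`. -/
def IsLogConcaveSeq (a : ℕ → ℝ) (m : ℕ) : Prop :=
  ∀ j, 1 ≤ j → j + 1 ≤ m → a (j - 1) * a (j + 1) ≤ a j ^ 2

/-- The finite sequence `a 0, a 1, …, a m` is unimodal: for some index `k`, it increases weakly
up to `k` and decreases weakly from `k` on. -/
def IsUnimodalSeq (a : ℕ → ℝ) (m : ℕ) : Prop :=
  ∃ k ≤ m, (∀ i, 1 ≤ i → i ≤ k → a (i - 1) ≤ a i) ∧ (∀ i, k ≤ i → i + 1 ≤ m → a (i + 1) ≤ a i)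

/-- The distance matrix of a graph. -/
noncomputable def distMatrix {V : Type*} (G : SimpleGraph V) : Matrix V V ℝ :=
  Matrix.of fun v w => (G.dist v w : ℝ)

/-- The distance characteristic polynomial `det (x I - D(G))`. -/
noncomputable def distCharpoly {V : Type*} [Fintype V] [DecidableEq V] (G : SimpleGraph V) :
    Polynomial ℝ :=
  (distMatrix G).charpoly

/-- The coefficient `δ_k(G)` of `x ^ k` in `det (D(G) - x I)`. -/
noncomputable def distDelta {V : Type*} [Fintype V] [DecidableEq V] (G : SimpleGraph V) (k : ℕ) :
    ℝ :=
  (((distMatrix G).map Polynomial.C - Matrix.scalar V (Polynomial.X : Polynomial ℝ)).det).coeff k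

/-- The normalized coefficient `d_k(G) = 2 ^ (k - n + 2) * |δ_k(G)|`, where `n` is the order of
`G`; the exponent is an integer. -/
noncomputable def distNormCoeff {V : Type*} [Fintype V] [DecidableEq V] (G : SimpleGraph V)
    (k : ℕ) : ℝ :=
  (2 : ℝ) ^ ((k : ℤ) - (Fintype.card V : ℤ) + 2) * |distDelta G k|

namespace Polynomial

theorem Splits.two_mul_coeff_zero_mul_coeff_two_le {p : ℝ[X]} (hp : p.Splits) :
    2 * (p.coeff 0 * p.coeff 2) ≤ p.coeff 1 ^ 2 := by
  obtain ⟨s, hs⟩ := splits_iff_exists_multiset.1 hp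
  suffices h : 2 * ((s.map fun a => X - C a).prod.coeff 0 * (s.map fun a => X - C a).prod.coeff 2) ≤
      (s.map fun a => X - C a).prod.coeff 1 ^ 2 by
    rw [hs]
    simp only [coeff_C_mul]
    nlinarith [mul_le_mul_of_nonneg_left h (sq_nonneg p.leadingCoeff)]
  clear hs
  induction s using Multiset.induction_on with
  | empty => simp [coeff_one]
  | cons r s ih =>
    rw [Multiset.map_cons, Multiset.prod_cons]
    set q := (s.map fun a => X - C a).prod
    have h0 : ((X - C r) * q).coeff 0 = -(r * q.coeff 0) := by simp [sub_mul]
    have h1 : ((X - C r) * q).coeff 1 = q.coeff 0 - r * q.coeff 1 := by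
      simp [sub_mul, coeff_X_mul q 0]
    have h2 : ((X - C r) * q).coeff 2 = q.coeff 1 - r * q.coeff 2 := by
      simp [sub_mul, coeff_X_mul q 1]
    rw [h0, h1, h2]
    nlinarith [mul_le_mul_of_nonneg_left ih (sq_nonneg r), sq_nonneg (q.coeff 0)]

theorem Splits.derivative_real {p : ℝ[X]} (hp : p.Splits) : p.derivative.Splits := by
  rw [splits_iff_card_roots] at hp ⊢
  have h1 := card_roots_le_derivative p
  have h2 := card_roots' p.derivative
  have h3 := natDegree_derivative_le p
  rcases Nat.eq_zero_or_pos p.natDegree with h | h <;> omega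

theorem Splits.iterate_derivative_real {p : ℝ[X]} (hp : p.Splits) (m : ℕ) :
    (derivative^[m] p).Splits := by
  induction m with
  | zero => exact hp
  | succ m ih => rw [Function.iterate_succ_apply']; exact ih.derivative_real

/-- A weak form of Newton's inequalities. -/
theorem Splits.coeff_mul_coeff_le_sq {p : ℝ[X]} (hp : p.Splits) (j : ℕ) :
    p.coeff j * p.coeff (j + 2) ≤ p.coeff (j + 1) ^ 2 := by
  have h := (hp.iterate_derivative_real j).two_mul_coeff_zero_mul_coeff_two_le
  simp only [coeff_iterate_derivative, nsmul_eq_mul, zero_add] at h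
  have e0 : ((j.descFactorial j : ℕ) : ℝ) = j.factorial := by rw [Nat.descFactorial_self]
  have e1 : (((1 + j).descFactorial j : ℕ) : ℝ) = (j + 1) * j.factorial := by
    have := Nat.factorial_mul_descFactorial (show j ≤ 1 + j by omega)
    rw [Nat.add_sub_cancel, Nat.factorial_one, one_mul, add_comm, Nat.factorial_succ] at this
    rw [add_comm, this]; push_cast; ring
  have e2 : 2 * (((2 + j).descFactorial j : ℕ) : ℝ) = (j + 2) * ((j + 1) * j.factorial) := by
    have := Nat.factorial_mul_descFactorial (show j ≤ 2 + j by omega)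
    rw [Nat.add_sub_cancel, Nat.factorial_two, add_comm, Nat.factorial_succ,
      Nat.factorial_succ] at this
    rw [add_comm 2 j]; exact_mod_cast this
  rw [e0, e1, add_comm 1 j, add_comm 2 j] at h
  rw [add_comm 2 j] at e2
  have hf : (0 : ℝ) < j.factorial := by exact_mod_cast j.factorial_pos
  have hj : (0 : ℝ) ≤ j := j.cast_nonneg
  have key : (j + 2 : ℝ) * (p.coeff j * p.coeff (j + 2)) ≤ (j + 1) * p.coeff (j + 1) ^ 2 := by
    refine le_of_mul_le_mul_left ?_ (show (0 : ℝ) < (j + 1) * j.factorial ^ 2 by positivity)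
    calc _ = j.factorial * p.coeff j * (((j : ℝ) + 2) * ((j + 1) * j.factorial) *
            p.coeff (j + 2)) := by ring
      _ ≤ ((j + 1) * j.factorial * p.coeff (j + 1)) ^ 2 := by
        rw [← e2]; exact le_trans (le_of_eq (by ring)) h
      _ = _ := by ring
  nlinarith [sq_nonneg (p.coeff (j + 1))]

section NonnegShifts

variable {ι : Type*} {μ : ι → ℝ}

theorem coeff_prod_X_add_C_nonneg (s : Finset ι) (hμ : ∀ i ∈ s, 0 ≤ μ i) (k : ℕ) :
    0 ≤ (∏ i ∈ s, (X + C (μ i))).coeff k := by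
  classical
  induction s using Finset.induction_on generalizing k with
  | empty => simp only [Finset.prod_empty, coeff_one]; split_ifs <;> norm_num
  | insert a s ha ih =>
    have ih' := ih fun i hi => hμ i (Finset.mem_insert_of_mem hi)
    have ha' := hμ a (Finset.mem_insert_self a s)
    rw [Finset.prod_insert ha, add_mul, coeff_add, coeff_C_mul]
    cases k with
    | zero => simpa using mul_nonneg ha' (ih' 0)
    | succ k => rw [coeff_X_mul]; exact add_nonneg (ih' k) (mul_nonneg ha' (ih' (k + 1)))

theorem coeff_card_prod_X_add_C (s : Finset ι) :
    (∏ i ∈ s, (X + C (μ i))).coeff s.card = 1 := by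
  have hm : (∏ i ∈ s, (X + C (μ i))).Monic := monic_prod_of_monic _ _ fun i _ => monic_X_add_C _
  have hd : (∏ i ∈ s, (X + C (μ i))).natDegree = s.card := by
    rw [natDegree_prod_of_monic _ _ fun i _ => monic_X_add_C _]; simp
  rw [← hd]; exact hm

theorem coeff_pred_card_prod_X_add_C (s : Finset ι) (k : ℕ) (hk : k + 1 = s.card) :
    (∏ i ∈ s, (X + C (μ i))).coeff k = ∑ i ∈ s, μ i := by
  classical
  induction s using Finset.induction_on generalizing k with
  | empty => simp at hk
  | insert a s ha ih =>
    rw [Finset.card_insert_of_notMem ha, add_left_inj] at hk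
    rw [Finset.prod_insert ha, Finset.sum_insert ha, add_mul, coeff_add, coeff_C_mul, hk,
      coeff_card_prod_X_add_C]
    rcases Nat.eq_zero_or_pos s.card with h | h
    · rw [h]; simp [Finset.card_eq_zero.1 h]
    · obtain ⟨m, hm⟩ := Nat.exists_eq_succ_of_ne_zero h.ne'
      rw [hm, Nat.succ_eq_add_one, coeff_X_mul, ih m hm.symm]; ring

theorem two_mul_coeff_prod_X_add_C_le (s : Finset ι) (hμ : ∀ i ∈ s, 0 ≤ μ i) (k : ℕ)
    (hk : k + 2 ≤ s.card) :
    2 * (∏ i ∈ s, (X + C (μ i))).coeff k ≤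
      (∑ i ∈ s, μ i) * (∏ i ∈ s, (X + C (μ i))).coeff (k + 1) := by
  classical
  induction s using Finset.induction_on generalizing k with
  | empty => simp at hk
  | insert a s ha ih =>
    have hμ' : ∀ i ∈ s, 0 ≤ μ i := fun i hi => hμ i (Finset.mem_insert_of_mem hi)
    have ha' := hμ a (Finset.mem_insert_self a s)
    have hnn := coeff_prod_X_add_C_nonneg s hμ'
    have hs : 0 ≤ ∑ i ∈ s, μ i := Finset.sum_nonneg hμ'
    rw [Finset.card_insert_of_notMem ha] at hk
    have hlast : 2 * (∏ i ∈ s, (X + C (μ i))).coeff k ≤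
        (∑ i ∈ s, μ i) * (∏ i ∈ s, (X + C (μ i))).coeff (k + 1) +
          (∏ i ∈ s, (X + C (μ i))).coeff k := by
      rcases Nat.lt_or_ge (k + 1) s.card with h | h
      · linarith [ih hμ' k h, hnn k]
      · have h' : k + 1 = s.card := by omega
        rw [h', coeff_card_prod_X_add_C, coeff_pred_card_prod_X_add_C s k h']; linarith
    have hfirst : 2 * (X * ∏ i ∈ s, (X + C (μ i))).coeff k ≤
        (∑ i ∈ s, μ i) * (∏ i ∈ s, (X + C (μ i))).coeff k := by
      cases k with
      | zero => simpa using mul_nonneg hs (hnn 0)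
      | succ k => rw [coeff_X_mul]; exact ih hμ' k (by omega)
    rw [Finset.prod_insert ha, Finset.sum_insert ha, add_mul, coeff_add, coeff_C_mul, coeff_add,
      coeff_C_mul, coeff_X_mul]
    nlinarith [mul_le_mul_of_nonneg_left hlast ha', mul_nonneg (mul_nonneg ha' ha') (hnn (k + 1))]

end NonnegShifts

end Polynomial

theorem Matrix.IsHermitian.eigenvalues_nonpos_of_ne {n : Type*} [Fintype n] [DecidableEq n]
    {A : Matrix n n ℝ} (hA : A.IsHermitian)
    (hneg : ∀ x : n → ℝ, ∑ i, x i = 0 → x ⬝ᵥ A.mulVec x ≤ 0) {i j : n} (hij : i ≠ j)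
    (hi : 0 < hA.eigenvalues i) : hA.eigenvalues j ≤ 0 := by
  by_contra! hj
  have hdot (k l : n) : (hA.eigenvectorBasis k).ofLp ⬝ᵥ (hA.eigenvectorBasis l).ofLp =
      if k = l then 1 else 0 := by
    rw [← orthonormal_iff_ite.1 hA.eigenvectorBasis.orthonormal k l,
      EuclideanSpace.inner_eq_star_dotProduct, dotProduct_comm]
    simp
  set u := (hA.eigenvectorBasis i).ofLp with hu
  set v := (hA.eigenvectorBasis j).ofLp with hv
  have hform (a b : ℝ) : (a • u + b • v) ⬝ᵥ A.mulVec (a • u + b • v) =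
      a ^ 2 * hA.eigenvalues i + b ^ 2 * hA.eigenvalues j := by
    rw [Matrix.mulVec_add, Matrix.mulVec_smul, Matrix.mulVec_smul, hA.mulVec_eigenvectorBasis,
      hA.mulVec_eigenvectorBasis, ← hu, ← hv]
    simp only [add_dotProduct, dotProduct_add, smul_dotProduct, dotProduct_smul, smul_eq_mul, hu,
      hv, hdot, hij, hij.symm, if_true, if_false]
    ring
  have hsum (a b : ℝ) : ∑ k, (a • u + b • v) k = a * ∑ k, u k + b * ∑ k, v k := by
    simp [Finset.sum_add_distrib, Finset.mul_sum]
  by_cases h : ∑ k, u k = 0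
  · have := hneg ((1 : ℝ) • u + (0 : ℝ) • v) (by rw [hsum, h]; ring)
    rw [hform] at this
    linarith
  · have := hneg ((∑ k, v k) • u + (-∑ k, u k) • v) (by rw [hsum]; ring)
    rw [hform] at this
    have h1 := mul_pos (pow_pos (abs_pos.2 h) 2) hj
    rw [sq_abs] at h1
    nlinarith [mul_nonneg (sq_nonneg (∑ k, v k)) hi.le]

theorem SimpleGraph.IsTree.dist_eq_card_filter_not_reachable {V : Type*} [Fintype V]
    {T : SimpleGraph V} (hT : T.IsTree) (v w : V) [Fintype T.edgeSet]
    [DecidablePred fun e => ¬(T.deleteEdges {e}).Reachable v w] :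
    T.dist v w = (T.edgeFinset.filter fun e => ¬(T.deleteEdges {e}).Reachable v w).card := by
  classical
  obtain ⟨p, hp, hlen⟩ := hT.connected.exists_path_of_dist v w
  rw [← hlen, ← SimpleGraph.Walk.length_edges, ← List.toFinset_card_of_nodup hp.isTrail.edges_nodup]
  congr 1
  ext e
  simp only [List.mem_toFinset, Finset.mem_filter, SimpleGraph.mem_edgeFinset]
  refine ⟨fun he => ⟨p.edges_subset_edgeSet he, fun hr => ?_⟩,
    fun he => p.mem_edges_of_not_reachable_deleteEdges he.2⟩
  obtain ⟨q, hq⟩ := hr.exists_isPath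
  have hle : T.deleteEdges {e} ≤ T := T.deleteEdges_le _
  have hpq : p = q.mapLe hle := (hT.existsUnique_path v w).unique hp (hq.mapLe hle)
  rw [hpq, SimpleGraph.Walk.edges_mapLe_eq_edges] at he
  simpa using q.edges_subset_edgeSet he

theorem sum_mul_ite_eq_nonneg {ι κ : Type*} [Fintype ι] [Fintype κ] [DecidableEq κ] (f : ι → κ)
    (x : ι → ℝ) : 0 ≤ ∑ v, ∑ w, x v * x w * (if f v = f w then 1 else 0) := by
  have : ∑ v, ∑ w, x v * x w * (if f v = f w then 1 else 0) =
      ∑ c, (∑ v, if f v = c then x v else 0) ^ 2 := by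
    simp only [sq, Finset.sum_mul_sum]
    rw [Finset.sum_comm]
    rw [Finset.sum_comm (s := (Finset.univ : Finset κ))]
    rw [Finset.sum_comm]
    refine Finset.sum_congr rfl fun v _ => ?_
    rw [Finset.sum_comm]
    refine Finset.sum_congr rfl fun w _ => ?_
    simp [ite_mul, mul_ite, eq_comm]
  rw [this]
  positivity

theorem SimpleGraph.IsTree.dotProduct_distMatrix_mulVec_nonpos {V : Type*} [Fintype V]
    {T : SimpleGraph V} (hT : T.IsTree) (x : V → ℝ) (hx : ∑ v, x v = 0) :
    x ⬝ᵥ (distMatrix T).mulVec x ≤ 0 := by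
  classical
  have hform : x ⬝ᵥ (distMatrix T).mulVec x = ∑ e ∈ T.edgeFinset, ∑ v, ∑ w,
      x v * x w * (if (T.deleteEdges {e}).Reachable v w then 0 else 1) := by
    simp only [dotProduct, Matrix.mulVec, distMatrix, Matrix.of_apply, Finset.mul_sum]
    rw [Finset.sum_comm (s := T.edgeFinset)]
    refine Finset.sum_congr rfl fun v _ => ?_
    rw [Finset.sum_comm (s := T.edgeFinset)]
    refine Finset.sum_congr rfl fun w _ => ?_
    rw [← Finset.mul_sum, hT.dist_eq_card_filter_not_reachable, Finset.card_filter]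
    push_cast
    simp only [ite_not]
    ring
  rw [hform]
  refine Finset.sum_nonpos fun e _ => ?_
  have h := sum_mul_ite_eq_nonneg (T.deleteEdges {e}).connectedComponentMk x
  simp only [SimpleGraph.ConnectedComponent.eq] at h
  have hsplit : ∑ v, ∑ w, x v * x w * (if (T.deleteEdges {e}).Reachable v w then 0 else 1 : ℝ) =
      (∑ v, x v) * (∑ v, x v) -
        ∑ v, ∑ w, x v * x w * (if (T.deleteEdges {e}).Reachable v w then 1 else 0) := by
    rw [Finset.sum_mul_sum, ← Finset.sum_sub_distrib]
    refine Finset.sum_congr rfl fun v _ => ?_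
    rw [← Finset.sum_sub_distrib]
    refine Finset.sum_congr rfl fun w _ => ?_
    split_ifs <;> ring
  rw [hsplit, hx]
  linarith

theorem distMatrix_isHermitian {V : Type*} (G : SimpleGraph V) : (distMatrix G).IsHermitian := by
  ext v w
  simp [distMatrix, SimpleGraph.dist_comm]

theorem trace_distMatrix {V : Type*} [Fintype V] (G : SimpleGraph V) :
    (distMatrix G).trace = 0 := by
  simp [Matrix.trace, distMatrix]

theorem distDelta_eq {V : Type*} [Fintype V] [DecidableEq V] (G : SimpleGraph V) (k : ℕ) :
    distDelta G k = (-1) ^ Fintype.card V * (distCharpoly G).coeff k := by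
  have : (distMatrix G).map Polynomial.C - Matrix.scalar V (Polynomial.X : Polynomial ℝ) =
      -(distMatrix G).charmatrix := by
    rw [Matrix.charmatrix, neg_sub]
    rfl
  rw [distDelta, this, Matrix.det_neg, distCharpoly, Matrix.charpoly,
    show (-1 : Polynomial ℝ) = Polynomial.C (-1) by simp, ← Polynomial.C_pow,
    Polynomial.coeff_C_mul]

theorem Matrix.IsHermitian.exists_forall_ne_eigenvalues_nonpos {n : Type*} [Fintype n]
    [DecidableEq n] [Nonempty n] {A : Matrix n n ℝ} (hA : A.IsHermitian)
    (hneg : ∀ x : n → ℝ, ∑ i, x i = 0 → x ⬝ᵥ A.mulVec x ≤ 0) :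
    ∃ i, ∀ j ≠ i, hA.eigenvalues j ≤ 0 := by
  by_cases h : ∃ i, 0 < hA.eigenvalues i
  · obtain ⟨i, hi⟩ := h
    exact ⟨i, fun j hj => hA.eigenvalues_nonpos_of_ne hneg hj.symm hi⟩
  · push Not at h
    exact ⟨Classical.arbitrary n, fun j _ => h j⟩

/-- The signs of the coefficients of the characteristic polynomial of a traceless symmetric
matrix whose quadratic form is nonpositive on the vectors with coordinate sum zero. -/
theorem Matrix.IsHermitian.charpoly_coeff_nonpos {n : Type*} [Fintype n] [DecidableEq n]
    {A : Matrix n n ℝ} (hA : A.IsHermitian) (htr : A.trace = 0)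
    (hneg : ∀ x : n → ℝ, ∑ i, x i = 0 → x ⬝ᵥ A.mulVec x ≤ 0) :
    (∀ k, k + 2 ≤ Fintype.card n → A.charpoly.coeff k ≤ 0) ∧
    ∀ k, k + 3 ≤ Fintype.card n → A.charpoly.coeff (k + 1) = 0 → A.charpoly.coeff k = 0 := by
  classical
  rcases isEmpty_or_nonempty n with h | h
  · simp
  obtain ⟨i, hi⟩ := hA.exists_forall_ne_eigenvalues_nonpos hneg
  set s := Finset.univ.erase i
  set q : Polynomial ℝ :=
    ∏ j ∈ s, (Polynomial.X + Polynomial.C (-hA.eigenvalues j)) with hq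
  have hcard : s.card + 1 = Fintype.card n := Finset.card_erase_add_one (Finset.mem_univ i)
  have hnn : ∀ j ∈ s, 0 ≤ -hA.eigenvalues j := fun j hj =>
    neg_nonneg.2 (hi j (Finset.ne_of_mem_erase hj))
  have hsum : hA.eigenvalues i = ∑ j ∈ s, -hA.eigenvalues j := by
    have := hA.trace_eq_sum_eigenvalues
    rw [htr, ← Finset.add_sum_erase _ _ (Finset.mem_univ i)] at this
    simp only [RCLike.ofReal_real_eq_id, id] at this
    rw [Finset.sum_neg_distrib]
    linarith
  have hP : A.charpoly = (Polynomial.X - Polynomial.C (hA.eigenvalues i)) * q := by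
    rw [hA.charpoly_eq, ← Finset.mul_prod_erase _ _ (Finset.mem_univ i), hq]
    simp [sub_eq_add_neg, s]
  have hq0 := Polynomial.coeff_prod_X_add_C_nonneg s hnn
  have hq1 := Polynomial.two_mul_coeff_prod_X_add_C_le s hnn
  have hl : 0 ≤ hA.eigenvalues i := hsum ▸ Finset.sum_nonneg hnn
  rw [← hsum, ← hq] at hq1
  rw [← hq] at hq0
  have hc0 : A.charpoly.coeff 0 = -(hA.eigenvalues i * q.coeff 0) := by rw [hP]; simp [sub_mul]
  have hc (k : ℕ) : A.charpoly.coeff (k + 1) = q.coeff k - hA.eigenvalues i * q.coeff (k + 1) := by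
    rw [hP]; simp [sub_mul]
  refine ⟨fun k hk => ?_, fun k hk hz => ?_⟩
  · cases k with
    | zero => rw [hc0]; linarith [mul_nonneg hl (hq0 0)]
    | succ k => rw [hc]; linarith [hq1 k (by omega), hq0 k]
  · rw [hc] at hz
    have hz' : q.coeff k = 0 := by linarith [hq1 k (by omega), hq0 k]
    cases k with
    | zero => rw [hc0, hz']; simp
    | succ k =>
      have := hq1 k (by omega)
      rw [hz'] at this
      rw [hc, hz']
      linarith [hq0 k]

theorem IsLogConcaveSeq.isUnimodalSeq {a : ℕ → ℝ} {m : ℕ} (h : IsLogConcaveSeq a m)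
    (h0 : ∀ i ≤ m, 0 ≤ a i) (hz : ∀ i, i + 1 ≤ m → a (i + 1) = 0 → a i = 0) :
    IsUnimodalSeq a m := by
  classical
  have hex : ∃ i, i = m ∨ a (i + 1) < a i := ⟨m, Or.inl rfl⟩
  have hkm : Nat.find hex ≤ m := Nat.find_min' hex (Or.inl rfl)
  have hdesc : ∀ i, Nat.find hex ≤ i → i + 1 ≤ m → a (i + 1) < a i := by
    intro i hi
    induction i, hi using Nat.le_induction with
    | base =>
      intro hm
      rcases Nat.find_spec hex with h1 | h1
      · omega
      · exact h1
    | succ i hi ih =>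
      intro hm
      have hlt := ih (by omega)
      have hpos : 0 < a (i + 1) := lt_of_le_of_ne (h0 _ (by omega)) fun he =>
        hlt.not_ge ((hz i (by omega) he.symm).le.trans he.le)
      have hlc := h (i + 1) (by omega) hm
      rw [Nat.add_sub_cancel] at hlc
      by_contra! hge
      nlinarith [mul_le_mul_of_nonneg_left hge (hpos.trans hlt).le]
  refine ⟨Nat.find hex, hkm, fun i h1 hi => ?_, fun i hi hm => (hdesc i hi hm).le⟩
  have := Nat.find_min hex (show i - 1 < Nat.find hex by omega)
  push Not at this
  simpa [Nat.sub_add_cancel h1] using this.2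

theorem IsLogConcaveSeq.congr {a b : ℕ → ℝ} {m : ℕ} (h : IsLogConcaveSeq a m)
    (hab : ∀ i ≤ m, a i = b i) : IsLogConcaveSeq b m := by
  intro j h1 hj
  rw [← hab _ (by omega), ← hab _ (by omega), ← hab _ (by omega)]
  exact h j h1 hj

theorem IsLogConcaveSeq.zpow_mul {a : ℕ → ℝ} {m : ℕ} (h : IsLogConcaveSeq a m) {c : ℝ}
    (hc : c ≠ 0) (z : ℤ) : IsLogConcaveSeq (fun k => c ^ ((k : ℤ) + z) * a k) m := by
  intro j h1 hj
  obtain ⟨i, rfl⟩ := Nat.exists_eq_add_of_le' h1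
  have hl := h (i + 1) h1 hj
  rw [Nat.add_sub_cancel] at hl ⊢
  have e : c ^ ((i : ℤ) + z) * c ^ (((i + 1 + 1 : ℕ) : ℤ) + z) =
      (c ^ (((i + 1 : ℕ) : ℤ) + z)) ^ 2 := by
    rw [sq, ← zpow_add₀ hc, ← zpow_add₀ hc]
    congr 1
    push_cast
    ring
  calc _ = c ^ ((i : ℤ) + z) * c ^ (((i + 1 + 1 : ℕ) : ℤ) + z) * (a i * a (i + 1 + 1)) := by ring
    _ ≤ (c ^ (((i + 1 : ℕ) : ℤ) + z)) ^ 2 * a (i + 1) ^ 2 := by rw [e]; gcongr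
    _ = _ := by ring

theorem IsUnimodalSeq.congr {a b : ℕ → ℝ} {m : ℕ} (h : IsUnimodalSeq a m)
    (hab : ∀ i ≤ m, a i = b i) : IsUnimodalSeq b m := by
  obtain ⟨k, hk, h1, h2⟩ := h
  refine ⟨k, hk, fun i hi hik => ?_, fun i hki hi => ?_⟩
  · rw [← hab _ (by omega), ← hab _ (by omega)]; exact h1 i hi hik
  · rw [← hab _ (by omega), ← hab _ (by omega)]; exact h2 i hki hi

theorem theorem2p1 {V : Type*} [Fintype V] [DecidableEq V] (T : SimpleGraph V) (hT : T.IsTree)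
    (n : ℕ) (hn : Fintype.card V = n) :
    IsLogConcaveSeq (fun k => (distCharpoly T).coeff k) n ∧
    (2 ≤ n →
      (IsLogConcaveSeq (fun k => |distDelta T k|) (n - 2) ∧
        IsUnimodalSeq (fun k => |distDelta T k|) (n - 2)) ∧
      (IsLogConcaveSeq (fun k => distNormCoeff T k) (n - 2) ∧
        IsUnimodalSeq (fun k => distNormCoeff T k) (n - 2)) ∧
      IsUnimodalSeq (fun k => (-1 : ℝ) ^ (n - 1) * distDelta T k / (2 : ℝ) ^ ((n : ℤ) - k - 2))
        (n - 2)) := by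
  have hH := distMatrix_isHermitian T
  have hlc : ∀ m, IsLogConcaveSeq (fun k => (distCharpoly T).coeff k) m := by
    intro m j h1 _
    obtain ⟨i, rfl⟩ := Nat.exists_eq_add_of_le' h1
    exact hH.splits_charpoly.coeff_mul_coeff_le_sq i
  refine ⟨hlc n, fun hn2 => ?_⟩
  obtain ⟨hsign, hzero⟩ := hH.charpoly_coeff_nonpos (trace_distMatrix T)
    hT.dotProduct_distMatrix_mulVec_nonpos
  rw [hn] at hsign hzero
  have habs : ∀ k ≤ n - 2, |distDelta T k| = -(distCharpoly T).coeff k := by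
    intro k hk
    rw [distDelta_eq, abs_mul, abs_neg_one_pow, one_mul, abs_of_nonpos]
    exact hsign k (by omega)
  have hlcd : IsLogConcaveSeq (fun k => |distDelta T k|) (n - 2) := by
    refine IsLogConcaveSeq.congr (a := fun k => -(distCharpoly T).coeff k) (fun j h1 hj => ?_)
      fun i hi => (habs i hi).symm
    simpa using hlc (n - 2) j h1 hj
  have hz : ∀ i, i + 1 ≤ n - 2 → |distDelta T (i + 1)| = 0 → |distDelta T i| = 0 := by
    intro i hi h
    rw [habs _ (by omega), neg_eq_zero] at h ⊢
    exact hzero i (by omega) h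
  have hnorm : distNormCoeff T = fun k : ℕ => (2 : ℝ) ^ ((k : ℤ) + (2 - n)) * |distDelta T k| := by
    funext k
    rw [distNormCoeff, hn, show (k : ℤ) - n + 2 = k + (2 - n) by ring]
  have hlcn : IsLogConcaveSeq (fun k => distNormCoeff T k) (n - 2) := by
    rw [hnorm]
    exact hlcd.zpow_mul two_ne_zero _
  have hun : IsUnimodalSeq (fun k => distNormCoeff T k) (n - 2) := by
    refine hlcn.isUnimodalSeq (fun i _ => ?_) fun i hi h => ?_
    · rw [hnorm]; positivity
    · rw [hnorm] at h ⊢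
      have h2 : (2 : ℝ) ^ (((i + 1 : ℕ) : ℤ) + (2 - n)) ≠ 0 := zpow_ne_zero _ two_ne_zero
      simp only [hz i hi ((mul_eq_zero.1 h).resolve_left h2), mul_zero]
  refine ⟨⟨hlcd, hlcd.isUnimodalSeq (fun i _ => abs_nonneg _) hz⟩, ⟨hlcn, hun⟩,
    hun.congr fun k hk => ?_⟩
  have hodd : (-1 : ℝ) ^ (n - 1) * (-1) ^ n = -1 := by
    rw [← pow_add]
    exact Odd.neg_one_pow ⟨n - 1, by omega⟩
  have hsgn : (-1 : ℝ) ^ (n - 1) * distDelta T k = |distDelta T k| := by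
    rw [habs k hk, distDelta_eq, hn, ← mul_assoc, hodd, neg_one_mul]
  rw [hnorm, hsgn, div_eq_mul_inv, ← zpow_neg, mul_comm,
    show -((n : ℤ) - k - 2) = k + (2 - n) by ring]
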